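/- Let $M_1,M_2$ be nonempty smooth manifolds of dimensions $n_1,n_2\ge 1$. A Finsler metric on a manifold $M$ is a function $F:TM\to[0,\infty)$ that is $C^\infty$ off the zero section, satisfies $F(cy)=cF(y)$ for $c>0$, and whose fundamental tensor $g_y(u,v)=\frac12\frac{\partial^2}{\partial s\partial t}F^2(y+su+tv)|_{s=t=0}$ is positive definite for every $y\ne0$. Let $F_1,F_2$ be Finsler metrics on $M_1,M_2$; if $n_i=1$, assume in addition that $F_i$ is reversible, i.e. $F_i(-y)=F_i(y)$. Let $f:M_1\times M_2\to(0,\infty)$ be smooth, and let $$F(v_1,v_2)=\sqrt{F_1(v_1)^2+f(x,u)^2F_2(v_2)^2},\qquad v_1\in T_xM_1,\ v_2\in T_uM_2,$$ be the twisted product metric on $M=M_1\times M_2$, of dimension $n=n_1+n_2$. At $y=(v_1,v_2)$ with $v_1\neq0$ and $v_2\ne0$ let $g_y$ be the fundamental tensor of $F$ (defined by the formula above), let $C_y(u,v,w)=\frac12\frac{d}{dt}g_{y+tw}(u,v)|_{t=0}$ be the Cartan torsion, with components $C_{abc}$, let $I_a=g^{bc}C_{abc}$ be the mean Cartan torsion,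 $h_{ab}=g_{ab}-\frac{1}{F^2}y_ay_b$ with $y_a=g_{ab}y^b$ the angular metric, and $$M_{abc}=C_{abc}-\frac1{n+1}\{I_ah_{bc}+I_bh_{ac}+I_ch_{ab}\}$$ the Matsumoto torsion. If $F$ is C-reducible, that is, if $M_{abc}=0$ at all $(v_1,v_2)\in TM_1\times TM_2$ with $v_1\ne0$ and $v_2\ne0$, then $F$, $F_1$ and $F_2$ are Riemannian, i.e. each is the norm of a smooth Riemannian metric. In other words, no non-Riemannian twisted product Finsler metric is C-reducible. -/

import Mathlib

open scoped Manifold ContDiff Topology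

noncomputable section

namespace Finsler

section General

variable {E : Type*} [NormedAddCommGroup E] [NormedSpace ℝ E]
  {H : Type*} [TopologicalSpace H] {I : ModelWithCorners ℝ E H}
  {M : Type*} [TopologicalSpace M] [ChartedSpace H M]

/-- The tangent vector `y + u` at the base point of `y`, for `y ∈ T_xM` and `u ∈ T_xM`. -/
def shift (y : TangentBundle I M) (u : TangentSpace I y.proj) : TangentBundle I M :=
  ⟨y.proj, y.snd + u⟩

/-- The fundamental tensor
`g_y(u, v) = (1/2) ∂²/∂s∂t [F²(y + s u + t v)]` at `s = t = 0`. -/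
def fundamentalTensor (F : TangentBundle I M → ℝ) (y : TangentBundle I M)
    (u v : TangentSpace I y.proj) : ℝ :=
  (1 / 2) * deriv (fun s : ℝ => deriv (fun t : ℝ => F (shift y (s • u + t • v)) ^ 2) 0) 0

/-- The Cartan torsion `C_y(u, v, w) = (1/2) d/dt [g_{y + t w}(u, v)]` at `t = 0`. -/
def cartanTorsion (F : TangentBundle I M → ℝ) (y : TangentBundle I M)
    (u v w : TangentSpace I y.proj) : ℝ :=
  (1 / 2) * deriv (fun t : ℝ => fundamentalTensor F (shift y (t • w)) u v) 0

/-- The angular metric `h_y(u, v) = g_y(u, v) - g_y(y, u) g_y(y, v) / F(y)²`, that is,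
`h_{ab} = g_{ab} - y_a y_b / F²` with `y_a = g_{ab} y^b`. -/
def angularMetric (F : TangentBundle I M → ℝ) (y : TangentBundle I M)
    (u v : TangentSpace I y.proj) : ℝ :=
  fundamentalTensor F y u v
    - fundamentalTensor F y y.snd u * fundamentalTensor F y y.snd v / F y ^ 2

/-- The matrix `(g_{ij})` of the fundamental tensor at `y`, in a basis of the model space `E`
(the tangent space `T_xM` is a copy of `E`). -/
def gramMatrix [FiniteDimensional ℝ E] (F : TangentBundle I M → ℝ) (y : TangentBundle I M) :
    Matrix (Fin (Module.finrank ℝ E)) (Fin (Module.finrank ℝ E)) ℝ :=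
  Matrix.of fun j k => fundamentalTensor F y (Module.finBasis ℝ E j) (Module.finBasis ℝ E k)

/-- The mean Cartan torsion `I_y(u) = g^{jk} C_y(u, e_j, e_k)`, where `(g^{jk})` is the inverse
of `(g_{jk})`; the value does not depend on the basis `(e_j)`, because the `C_y(u, ·, ·)` and
`g_y` that occur are bilinear. -/
def meanCartanTorsion [FiniteDimensional ℝ E] (F : TangentBundle I M → ℝ)
    (y : TangentBundle I M) (u : TangentSpace I y.proj) : ℝ :=
  ∑ j, ∑ k, (gramMatrix F y)⁻¹ j k *
    cartanTorsion F y u (Module.finBasis ℝ E j) (Module.finBasis ℝ E k)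

/-- The Matsumoto torsion
`M_{abc} = C_{abc} - (1/(n+1)) (I_a h_{bc} + I_b h_{ac} + I_c h_{ab})`, with `n` the dimension. -/
def matsumotoTorsion [FiniteDimensional ℝ E] (F : TangentBundle I M → ℝ)
    (y : TangentBundle I M) (u v w : TangentSpace I y.proj) : ℝ :=
  cartanTorsion F y u v w - 1 / ((Module.finrank ℝ E : ℝ) + 1) *
    (meanCartanTorsion F y u * angularMetric F y v w
      + meanCartanTorsion F y v * angularMetric F y u w
      + meanCartanTorsion F y w * angularMetric F y u v)

/-- `F` is C-reducible on a set `S` of tangent vectors: its Matsumoto torsion vanishes there. -/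
def IsCReducibleOn [FiniteDimensional ℝ E] (F : TangentBundle I M → ℝ)
    (S : Set (TangentBundle I M)) : Prop :=
  ∀ y ∈ S, ∀ u v w : TangentSpace I y.proj, matsumotoTorsion F y u v w = 0

/-- A Finsler metric on `M`: a nonnegative function on `TM`, smooth off the zero section,
positively homogeneous of degree one on the fibres, with positive definite fundamental tensor
at every nonzero vector. -/
structure IsFinslerMetric [IsManifold I ∞ M] (F : TangentBundle I M → ℝ) : Prop where
  nonneg : ∀ y, 0 ≤ F y
  smooth : ContMDiffOn I.tangent 𝓘(ℝ, ℝ) ∞ F {y | y.snd ≠ 0}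
  homogeneous : ∀ (x : M) (y : TangentSpace I x) (c : ℝ), 0 < c → F ⟨x, c • y⟩ = c * F ⟨x, y⟩
  posDef : ∀ y : TangentBundle I M, y.snd ≠ 0 →
    ∀ u : TangentSpace I y.proj, u ≠ 0 → 0 < fundamentalTensor F y u u

/-- `F` is reversible: `F(-y) = F(y)`. -/
def IsReversible (F : TangentBundle I M → ℝ) : Prop :=
  ∀ (x : M) (y : TangentSpace I x), F ⟨x, -y⟩ = F ⟨x, y⟩

/-- `F` is Riemannian: it is the norm of a smooth Riemannian metric on `M`. -/
def IsRiemannian [IsManifold I ∞ M] (F : TangentBundle I M → ℝ) : Prop :=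
  ∃ g : Bundle.ContMDiffRiemannianMetric I ∞ E (fun x : M => TangentSpace I x),
    ∀ (x : M) (y : TangentSpace I x), F ⟨x, y⟩ = √(g.inner x y y)

end General

section Twisted

variable {E₁ : Type*} [NormedAddCommGroup E₁] [NormedSpace ℝ E₁]
  {H₁ : Type*} [TopologicalSpace H₁] {I₁ : ModelWithCorners ℝ E₁ H₁}
  {M₁ : Type*} [TopologicalSpace M₁] [ChartedSpace H₁ M₁]
  {E₂ : Type*} [NormedAddCommGroup E₂] [NormedSpace ℝ E₂]
  {H₂ : Type*} [TopologicalSpace H₂] {I₂ : ModelWithCorners ℝ E₂ H₂}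
  {M₂ : Type*} [TopologicalSpace M₂] [ChartedSpace H₂ M₂]

/-- The twisted product metric `F(v₁, v₂) = √(F₁(v₁)² + f(x, u)² F₂(v₂)²)` on `M₁ × M₂`, for
`v₁ ∈ T_xM₁` and `v₂ ∈ T_uM₂`. -/
def twistedProduct (F₁ : TangentBundle I₁ M₁ → ℝ) (F₂ : TangentBundle I₂ M₂ → ℝ)
    (f : M₁ × M₂ → ℝ) (v : TangentBundle (I₁.prod I₂) (M₁ × M₂)) : ℝ :=
  √(F₁ (equivTangentBundleProd I₁ M₁ I₂ M₂ v).1 ^ 2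
    + f v.proj ^ 2 * F₂ (equivTangentBundleProd I₁ M₁ I₂ M₂ v).2 ^ 2)

/-- The domain `TM₁° × TM₂°` of the twisted product metric: the tangent vectors `(v₁, v₂)` of
`M₁ × M₂` with `v₁ ≠ 0` and `v₂ ≠ 0`. (Off this set the twisted product metric need not be
twice differentiable.) -/
def slitProduct (I₁ : ModelWithCorners ℝ E₁ H₁) (M₁ : Type*) [TopologicalSpace M₁]
    [ChartedSpace H₁ M₁]
    (I₂ : ModelWithCorners ℝ E₂ H₂) (M₂ : Type*) [TopologicalSpace M₂]
    [ChartedSpace H₂ M₂] :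
    Set (TangentBundle (I₁.prod I₂) (M₁ × M₂)) :=
  {v | (equivTangentBundleProd I₁ M₁ I₂ M₂ v).1.snd ≠ 0 ∧
    (equivTangentBundleProd I₁ M₁ I₂ M₂ v).2.snd ≠ 0}

end Twisted

end Finsler

end

/-! On the fibre over a point, F² is G₁(v₁) + c G₂(v₂), with Gᵢ the square of Fᵢ and c = f²
constant. Mixed second and third derivatives vanish, so the Hessian and the Cartan torsion C split
into blocks (`halfHessian_prod`, `halfThird_prod`). By Euler's relations, C dies on the radial
vectors (v₁, 0) and (0, v₂), hence so does its trace I, whereas h((v₁, 0), (0, v₂)) = -c G₁ G₂ / F²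
is nonzero. The equation M(u, (v₁, 0), (0, v₂)) = 0 therefore reduces to I(u) = 0, and M = 0 then
gives C = 0 (`halfThird_eq_zero_of_cReducible`).

Each block of C vanishes separately, so the Hessian of Gᵢ is constant on the punctured fibre if that
is connected. In dimension one reversibility replaces connectedness
(`exists_bilin_of_halfThird_eq_zero`). Thus each Fᵢ² is quadratic on fibres, and so is F².
Polarization turns smoothness of the squares into smoothness of the metrics
(`isRiemannian_of_quadratic`). -/

namespace Finsler

/-! ### Second and third derivatives on a vector space; Euler's relations -/

section Calculus

variable {E : Type*} [NormedAddCommGroup E] [NormedSpace ℝ E]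
  {E' : Type*} [NormedAddCommGroup E'] [NormedSpace ℝ E']

/-- The tensor `(1/2) ∂²/∂s∂t G(y + s u + t v)` at `s = t = 0` of a function on a vector space. -/
noncomputable def halfHessian (G : E → ℝ) (y u v : E) : ℝ :=
  (1 / 2) * deriv (fun s : ℝ => deriv (fun t : ℝ => G (y + (s • u + t • v))) 0) 0

/-- The tensor `(1/2) d/dt` of `halfHessian G (y + t w) u v` at `t = 0`. -/
noncomputable def halfThird (G : E → ℝ) (y u v w : E) : ℝ :=
  (1 / 2) * deriv (fun t : ℝ => halfHessian G (y + t • w) u v) 0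

lemma hasDerivAt_add_smul (y u : E) : HasDerivAt (fun t : ℝ => y + t • u) u 0 := by
  simpa using ((hasDerivAt_id (0 : ℝ)).smul_const u).const_add y

lemma hasDerivAt_line {G : E → E'} {y : E} (h : DifferentiableAt ℝ G y) (u : E) :
    HasDerivAt (fun t : ℝ => G (y + t • u)) (fderiv ℝ G y u) 0 := by
  have h' : HasFDerivAt G (fderiv ℝ G y) (y + (0 : ℝ) • u) := by simpa using h.hasFDerivAt
  exact h'.comp_hasDerivAt (0 : ℝ) (hasDerivAt_add_smul y u)

lemma _root_.HasDerivAt.clm_apply_vec {T : ℝ → E →L[ℝ] E'} {T' : E →L[ℝ] E'} {x : ℝ}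
    (h : HasDerivAt T T' x) (v : E) : HasDerivAt (fun t => T t v) (T' v) x := by
  simpa using h.clm_apply (hasDerivAt_const x v)

lemma tendsto_line (y u : E) : Filter.Tendsto (fun t : ℝ => y + t • u) (𝓝 0) (𝓝 y) := by
  simpa using (hasDerivAt_add_smul y u).continuousAt.tendsto

lemma hasDerivAt_fderiv_line {G : E → ℝ} {y : E} (h : ContDiffAt ℝ 2 G y) (u v : E) :
    HasDerivAt (fun s : ℝ => fderiv ℝ G (y + s • u) v) (fderiv ℝ (fderiv ℝ G) y u v) 0 :=
  (hasDerivAt_line ((h.fderiv_right (m := 1) (by norm_num)).differentiableAt (by norm_num))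
    u).clm_apply_vec v

/-- Being C² at `y` persists nearby, so for small `s` the inner `deriv` is a genuine directional
derivative. -/
lemma halfHessian_eq {G : E → ℝ} {y : E} (h : ContDiffAt ℝ 2 G y) (u v : E) :
    halfHessian G y u v = (1 / 2) * fderiv ℝ (fderiv ℝ G) y u v := by
  have hev : (fun s : ℝ => deriv (fun t : ℝ => G (y + (s • u + t • v))) 0)
      =ᶠ[𝓝 0] fun s => fderiv ℝ G (y + s • u) v := by
    filter_upwards [(tendsto_line y u).eventually (h.eventually (by simp))] with s hs
    simp_rw [← add_assoc]
    exact (hasDerivAt_line (hs.differentiableAt (by norm_num)) v).deriv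
  rw [halfHessian, hev.deriv_eq, (hasDerivAt_fderiv_line h u v).deriv]

lemma hasDerivAt_halfHessian {G : E → ℝ} {y : E} (h : ContDiffAt ℝ 3 G y) (u v w : E) :
    HasDerivAt (fun t : ℝ => halfHessian G (y + t • w) u v)
      ((1 / 2) * fderiv ℝ (fderiv ℝ (fderiv ℝ G)) y w u v) 0 := by
  have hev : (fun t : ℝ => halfHessian G (y + t • w) u v)
      =ᶠ[𝓝 0] fun t => (1 / 2) * fderiv ℝ (fderiv ℝ G) (y + t • w) u v := by
    filter_upwards [(tendsto_line y w).eventually (h.eventually (by simp))] with s hs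
    exact halfHessian_eq (hs.of_le (by norm_num)) u v
  have h2 : ContDiffAt ℝ 1 (fderiv ℝ (fderiv ℝ G)) y :=
    (h.fderiv_right (m := 2) (by norm_num)).fderiv_right (m := 1) (by norm_num)
  exact ((((hasDerivAt_line (h2.differentiableAt (by norm_num)) w).clm_apply_vec u).clm_apply_vec
    v).const_mul (1 / 2)).congr_of_eventuallyEq hev

/-- The 1/4 is the product of the two factors 1/2. The direction `w`, differentiated last, is the
first argument of the iterated `fderiv`. -/
lemma halfThird_eq {G : E → ℝ} {y : E} (h : ContDiffAt ℝ 3 G y) (u v w : E) :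
    halfThird G y u v w = (1 / 4) * fderiv ℝ (fderiv ℝ (fderiv ℝ G)) y w u v := by
  rw [halfThird, (hasDerivAt_halfHessian h u v w).deriv]
  ring

variable {G : E → ℝ} {G' : E' → ℝ} {c : ℝ}

lemma halfHessian_prod {p : E × E'} (h : ContDiffAt ℝ 2 G p.1) (h' : ContDiffAt ℝ 2 G' p.2)
    (u v : E × E') :
    halfHessian (fun q : E × E' => G q.1 + c * G' q.2) p u v =
      halfHessian G p.1 u.1 v.1 + c * halfHessian G' p.2 u.2 v.2 := by
  have hev : (fun s : ℝ => deriv (fun t : ℝ => (fun q : E × E' => G q.1 + c * G' q.2)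
        (p + (s • u + t • v))) 0)
      =ᶠ[𝓝 0] fun s => fderiv ℝ G (p.1 + s • u.1) v.1 + c * fderiv ℝ G' (p.2 + s • u.2) v.2 := by
    filter_upwards [(tendsto_line p.1 u.1).eventually (h.eventually (by simp)),
      (tendsto_line p.2 u.2).eventually (h'.eventually (by simp))] with s hs hs'
    simp_rw [← add_assoc]
    exact ((hasDerivAt_line (hs.differentiableAt (by norm_num)) v.1).add
      ((hasDerivAt_line (hs'.differentiableAt (by norm_num)) v.2).const_mul c)).deriv
  rw [halfHessian, hev.deriv_eq, ((hasDerivAt_fderiv_line h u.1 v.1).fun_add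
    ((hasDerivAt_fderiv_line h' u.2 v.2).const_mul c)).deriv, halfHessian_eq h, halfHessian_eq h']
  ring

lemma halfThird_prod {p : E × E'} (h : ContDiffAt ℝ 3 G p.1) (h' : ContDiffAt ℝ 3 G' p.2)
    (u v w : E × E') :
    halfThird (fun q : E × E' => G q.1 + c * G' q.2) p u v w =
      halfThird G p.1 u.1 v.1 w.1 + c * halfThird G' p.2 u.2 v.2 w.2 := by
  have hev : (fun t : ℝ => halfHessian (fun q : E × E' => G q.1 + c * G' q.2) (p + t • w) u v)
      =ᶠ[𝓝 0] fun t => halfHessian G (p.1 + t • w.1) u.1 v.1 +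
        c * halfHessian G' (p.2 + t • w.2) u.2 v.2 := by
    filter_upwards [(tendsto_line p.1 w.1).eventually (h.eventually (by simp)),
      (tendsto_line p.2 w.2).eventually (h'.eventually (by simp))] with t ht ht'
    exact halfHessian_prod (p := p + t • w) (ht.of_le (by norm_num)) (ht'.of_le (by norm_num)) u v
  rw [halfThird, hev.deriv_eq, ((hasDerivAt_halfHessian h u.1 v.1 w.1).fun_add
    ((hasDerivAt_halfHessian h' u.2 v.2 w.2).const_mul c)).deriv, halfThird_eq h, halfThird_eq h']
  ring

section Homogeneous

variable (hG : ∀ y ≠ 0, ContDiffAt ℝ 3 G y) (hom : ∀ (c : ℝ) (y : E), 0 < c → G (c • y) = c ^ 2 * G y)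
include hG hom

/-- Differentiate G((1 + t) y) = (1 + t)² G(y) at t = 0. -/
lemma fderiv_self_of_homogeneous {y : E} (hy : y ≠ 0) : fderiv ℝ G y y = 2 * G y := by
  have h1 := hasDerivAt_line ((hG y hy).differentiableAt (by norm_num)) y
  have h2 : (fun t : ℝ => G (y + t • y)) =ᶠ[𝓝 0] fun t => (1 + t) ^ 2 * G y := by
    filter_upwards [lt_mem_nhds (show (-1 : ℝ) < 0 by norm_num)] with t ht
    rw [← hom _ _ (by linarith), add_smul, one_smul]
  have h3 : HasDerivAt (fun t : ℝ => (1 + t) ^ 2 * G y) (2 * G y) 0 := by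
    simpa using (((hasDerivAt_id (0 : ℝ)).const_add 1).pow 2).mul_const (G y)
  exact h1.unique (h3.congr_of_eventuallyEq h2)

/-- Differentiating DG_z(z) = 2 G(z) in `z` gives D²G_y(v, y) + DG_y(v) = 2 DG_y(v); symmetry of D²G
moves `y` to the first slot. -/
lemma fderiv_fderiv_self_of_homogeneous {y : E} (hy : y ≠ 0) :
    fderiv ℝ (fderiv ℝ G) y y = fderiv ℝ G y := by
  ext v
  have h := hG y hy
  have hsymm : IsSymmSndFDerivAt ℝ G y := h.isSymmSndFDerivAt (by norm_num)
  rw [hsymm.eq]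
  have hev : (fun z => fderiv ℝ G z z) =ᶠ[𝓝 y] fun z => 2 * G z := by
    filter_upwards [isOpen_ne.mem_nhds hy] with z hz
    exact fderiv_self_of_homogeneous hG hom hz
  have h1 : HasFDerivAt (fun z => fderiv ℝ G z z) _ y :=
    ((h.fderiv_right (m := 2) (by norm_num)).differentiableAt (by norm_num)).hasFDerivAt.clm_apply
      (hasFDerivAt_id y)
  have h2 := (h.differentiableAt (by norm_num)).hasFDerivAt.const_mul (2 : ℝ)
  have := congrArg (fun T : E →L[ℝ] ℝ => T v) (h1.unique (h2.congr_of_eventuallyEq hev))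
  simp at this
  linarith

lemma halfHessian_self_left {y : E} (hy : y ≠ 0) (v : E) :
    halfHessian G y y v = (1 / 2) * fderiv ℝ G y v := by
  rw [halfHessian_eq ((hG y hy).of_le (by norm_num)), fderiv_fderiv_self_of_homogeneous hG hom hy]

lemma halfHessian_self {y : E} (hy : y ≠ 0) : halfHessian G y y y = G y := by
  rw [halfHessian_self_left hG hom hy, fderiv_self_of_homogeneous hG hom hy]
  ring

/-- Differentiate D²G_z(z, ·) = DG_z once more: the second-order terms on both sides cancel. -/
lemma halfThird_self_left {y : E} (hy : y ≠ 0) (v w : E) : halfThird G y y v w = 0 := by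
  have h := hG y hy
  have hev : (fun z => fderiv ℝ (fderiv ℝ G) z z) =ᶠ[𝓝 y] fderiv ℝ G := by
    filter_upwards [isOpen_ne.mem_nhds hy] with z hz
    exact fderiv_fderiv_self_of_homogeneous hG hom hz
  have hD : ContDiffAt ℝ 2 (fderiv ℝ G) y := h.fderiv_right (by norm_num)
  have hD2 : ContDiffAt ℝ 1 (fderiv ℝ (fderiv ℝ G)) y := hD.fderiv_right (by norm_num)
  have h1 : HasFDerivAt (fun z => fderiv ℝ (fderiv ℝ G) z z) _ y :=
    (hD2.differentiableAt (by norm_num)).hasFDerivAt.clm_apply (hasFDerivAt_id y)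
  have h2 := (hD.differentiableAt (by norm_num)).hasFDerivAt
  have := congrArg (fun T : E →L[ℝ] E →L[ℝ] ℝ => T w v)
    (h1.unique (h2.congr_of_eventuallyEq hev))
  rw [halfThird_eq h]
  simp at this
  linarith

end Homogeneous

lemma halfThird_zero_left {y : E} (h : ContDiffAt ℝ 3 G y) (v w : E) :
    halfThird G y 0 v w = 0 := by
  simp [halfThird_eq h]

lemma halfThird_zero_middle {y : E} (h : ContDiffAt ℝ 3 G y) (u w : E) :
    halfThird G y u 0 w = 0 := by
  simp [halfThird_eq h]

lemma halfThird_zero_right {y : E} (h : ContDiffAt ℝ 3 G y) (u v : E) :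
    halfThird G y u v 0 = 0 := by
  simp [halfThird_eq h]

lemma halfHessian_zero_left {y : E} (h : ContDiffAt ℝ 2 G y) (v : E) :
    halfHessian G y 0 v = 0 := by
  simp [halfHessian_eq h]

lemma halfHessian_zero_right {y : E} (h : ContDiffAt ℝ 2 G y) (u : E) :
    halfHessian G y u 0 = 0 := by
  simp [halfHessian_eq h]

/-- A function, smooth off the origin and positively homogeneous of degree two, whose third
derivative vanishes off the origin is a quadratic form. In dimension one evenness is needed. -/
lemma exists_bilin_of_halfThird_eq_zero [FiniteDimensional ℝ E]
    (hG : ∀ y ≠ 0, ContDiffAt ℝ 3 G y)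
    (hom : ∀ (c : ℝ) (y : E), 0 < c → G (c • y) = c ^ 2 * G y)
    (heven : Module.finrank ℝ E = 1 → ∀ y, G (-y) = G y)
    (hC : ∀ y ≠ 0, ∀ u v w, halfThird G y u v w = 0) :
    ∃ B : E →L[ℝ] E →L[ℝ] ℝ, ∀ y, G y = B y y := by
  have hG0 : G 0 = 0 := by
    have := hom 2 0 (by norm_num)
    rw [smul_zero] at this
    linarith
  rcases subsingleton_or_nontrivial E with hE | hE
  · exact ⟨0, fun y => by simp [Subsingleton.elim y 0, hG0]⟩
  obtain ⟨e, he⟩ := exists_ne (0 : E)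
  -- By Euler, G(z) is half the Hessian at `z` evaluated on (z, z); any nonzero `e` serves as base
  -- point once the Hessian is constant.
  refine ⟨(1 / 2 : ℝ) • fderiv ℝ (fderiv ℝ G) e, fun y => ?_⟩
  have key : ∀ z ≠ 0, G z = ((1 / 2 : ℝ) • fderiv ℝ (fderiv ℝ G) z) z z := fun z hz => by
    rw [← halfHessian_self hG hom hz, halfHessian_eq ((hG z hz).of_le (by norm_num))]
    simp [fderiv_fderiv_self_of_homogeneous hG hom hz]
  rcases eq_or_ne y 0 with rfl | hy
  · simp [hG0]
  -- The punctured line is disconnected: homogeneity handles positive multiples of `e`, evenness the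
  -- negative ones.
  by_cases h1 : Module.finrank ℝ E = 1
  · obtain ⟨c, rfl⟩ := (finrank_eq_one_iff_of_nonzero' e he).1 h1 y
    have hc : c ≠ 0 := by rintro rfl; simp at hy
    have : G (c • e) = c ^ 2 * G e := by
      rcases hc.lt_or_gt with h | h
      · rw [← heven h1, ← neg_smul, hom _ _ (by linarith)]
        ring
      · exact hom _ _ h
    rw [this, key e he]
    simp
    ring
  -- From dimension two on, the punctured space is connected, so the Hessian, having zero
  -- derivative, is constant on it.
  · have hrank : 1 < Module.rank ℝ E := by
      rw [← Module.finrank_eq_rank, ← Nat.cast_one, Nat.cast_lt]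
      have := Module.finrank_pos (R := ℝ) (M := E)
      omega
    have hdiff : ∀ z ≠ 0, DifferentiableAt ℝ (fderiv ℝ (fderiv ℝ G)) z := fun z hz =>
      (((hG z hz).fderiv_right (m := 2) (by norm_num)).fderiv_right (m := 1)
        (by norm_num)).differentiableAt (by norm_num)
    have hconst := isOpen_compl_singleton.is_const_of_fderiv_eq_zero (𝕜 := ℝ)
      (f := fderiv ℝ (fderiv ℝ G))
      (isConnected_compl_singleton_of_one_lt_rank hrank (0 : E)).isPreconnected
      (fun z hz => (hdiff z hz).differentiableWithinAt)
      (fun z hz => by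
        ext w u v
        have := hC z hz u v w
        rw [halfThird_eq (hG z hz)] at this
        simpa using this) he hy
    rw [key y hy, hconst]

end Calculus

/-! ### From fibrewise quadratic functions to smooth Riemannian metrics -/

section Riemannian

open Bundle

variable {E : Type*} [NormedAddCommGroup E] [NormedSpace ℝ E]
  {H : Type*} [TopologicalSpace H] {I : ModelWithCorners ℝ E H}
  {M : Type*} [TopologicalSpace M] [ChartedSpace H M]

/-- Expanding over a basis makes `φ z` a fixed linear expression in its finitely many values on
basis vectors. -/
lemma contMDiffAt_clm_of_apply [FiniteDimensional ℝ E] {V : Type*} [NormedAddCommGroup V]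
    [NormedSpace ℝ V] {EN : Type*} [NormedAddCommGroup EN] [NormedSpace ℝ EN]
    {HN : Type*} [TopologicalSpace HN] {J : ModelWithCorners ℝ EN HN}
    {N : Type*} [TopologicalSpace N] [ChartedSpace HN N] {n : WithTop ℕ∞}
    {φ : N → E →L[ℝ] V} {x : N} (h : ∀ e, ContMDiffAt J 𝓘(ℝ, V) n (fun z => φ z e) x) :
    ContMDiffAt J 𝓘(ℝ, E →L[ℝ] V) n φ x := by
  have hφ : φ = fun z => ∑ i, ContinuousLinearMap.smulRightL ℝ E V
      (LinearMap.toContinuousLinearMap ((Module.finBasis ℝ E).coord i))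
      (φ z (Module.finBasis ℝ E i)) := by
    ext z e
    conv_lhs => rw [← (Module.finBasis ℝ E).sum_repr e, map_sum]
    simp
  rw [hφ]
  refine ContMDiffAt.sum fun i _ => ?_
  exact (ContinuousLinearMap.contMDiff _).contMDiffAt.comp x (h _)

/-- With m > 0 the minimum of B(v, v) on the compact unit sphere, B(v, v) ≥ m ‖v‖², so the set lies
in the ball of radius √(1/m). -/
lemma isVonNBounded_of_posDef [FiniteDimensional ℝ E] (B : E →L[ℝ] E →L[ℝ] ℝ)
    (pos : ∀ v ≠ 0, 0 < B v v) : Bornology.IsVonNBounded ℝ {v : E | B v v < 1} := by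
  rw [NormedSpace.isVonNBounded_iff]
  rcases subsingleton_or_nontrivial E with hE | hE
  · exact (Set.toFinite _).isBounded
  have hcont : Continuous fun v => B v v := by fun_prop
  obtain ⟨v₀, hv₀, hmin⟩ := (isCompact_sphere (0 : E) 1).exists_isMinOn
    (NormedSpace.sphere_nonempty.2 zero_le_one) hcont.continuousOn
  have hv₀' : v₀ ≠ 0 := by
    rintro rfl
    simp at hv₀
  have hm := pos v₀ hv₀'
  refine (Metric.isBounded_closedBall (x := (0 : E)) (r := √(1 / B v₀ v₀))).subset fun v hv => ?_
  rw [mem_closedBall_zero_iff]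
  refine Real.le_sqrt_of_sq_le ?_
  rcases eq_or_ne v 0 with rfl | hv0
  · simp [hm.le]
  have hn : 0 < ‖v‖ := norm_pos_iff.2 hv0
  have h1 : B v₀ v₀ ≤ B (‖v‖⁻¹ • v) (‖v‖⁻¹ • v) := hmin (by simp [norm_smul, hn.ne'])
  have h2 : B (‖v‖⁻¹ • v) (‖v‖⁻¹ • v) = B v v / ‖v‖ ^ 2 := by
    simp
    field_simp
  rw [h2, le_div_iff₀ (by positivity)] at h1
  rw [le_div_iff₀ hm]
  have : B v v < 1 := hv
  nlinarith

variable [IsManifold I ∞ M]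

/-- A function on the tangent bundle whose square is smooth off the zero section, positive there
and quadratic on every fibre is the norm of a Riemannian metric. -/
lemma isRiemannian_of_quadratic [FiniteDimensional ℝ E] {F : TangentBundle I M → ℝ}
    (nonneg : ∀ y, 0 ≤ F y)
    (smooth : ∀ y, y.snd ≠ 0 → ContMDiffAt I.tangent 𝓘(ℝ, ℝ) ∞ (fun z => F z ^ 2) y)
    (pos : ∀ y, y.snd ≠ 0 → 0 < F y)
    (quad : ∀ x : M, ∃ B : TangentSpace I x →L[ℝ] TangentSpace I x →L[ℝ] ℝ,
      ∀ y, F ⟨x, y⟩ ^ 2 = B y y) : IsRiemannian F := by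
  -- The given forms need not be symmetric; symmetrizing keeps the quadratic form.
  have quad' : ∀ x : M, ∃ B : TangentSpace I x →L[ℝ] TangentSpace I x →L[ℝ] ℝ,
      (∀ v w, B v w = B w v) ∧ ∀ y, F ⟨x, y⟩ ^ 2 = B y y := fun x => by
    obtain ⟨B, hB⟩ := quad x
    let B' : E →L[ℝ] E →L[ℝ] ℝ := B
    refine ⟨((1 / 2 : ℝ) • (B' + B'.flip) : E →L[ℝ] E →L[ℝ] ℝ), fun v w => ?_, fun y => ?_⟩
    · show (1 / 2 : ℝ) * (B' v w + B' w v) = (1 / 2 : ℝ) * (B' w v + B' v w)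
      ring
    · show _ = (1 / 2 : ℝ) * (B y y + B y y)
      rw [hB]
      ring
  choose B hsymm hB using quad'
  -- The forms were chosen pointwise; polarization recovers them from F² and so makes them depend
  -- smoothly on `x`.
  have hpol : ∀ x v w, B x v w = (1 / 2) * (F ⟨x, v + w⟩ ^ 2 - F ⟨x, v⟩ ^ 2 - F ⟨x, w⟩ ^ 2) := by
    intro x v w
    rw [hB, hB, hB, map_add, map_add, add_apply,
      add_apply, hsymm x w v]
    ring
  have hpos : ∀ x v, v ≠ 0 → 0 < B x v v := fun x v hv => by
    rw [← hB]
    exact pow_pos (pos ⟨x, v⟩ hv) 2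
  refine ⟨⟨B, hsymm, hpos, fun x => isVonNBounded_of_posDef (E := E) (B x) (hpos x), fun x₀ => ?_⟩,
    fun x y => by rw [← hB, Real.sqrt_sq (nonneg _)]⟩
  have hx₀ : x₀ ∈ (trivializationAt E (TangentSpace I) x₀).baseSet :=
    FiberBundle.mem_baseSet_trivializationAt' x₀
  have hnhds := (trivializationAt E (TangentSpace I) x₀).open_baseSet.mem_nhds hx₀
  have hsec : ∀ e : E, ContMDiffAt I 𝓘(ℝ, ℝ) ∞
      (fun x => F ⟨x, (trivializationAt E (TangentSpace I) x₀).symm x e⟩ ^ 2) x₀ := fun e => by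
    -- F² is only assumed smooth off the zero section; along the zero section it is identically 0.
    rcases eq_or_ne e 0 with rfl | he
    · refine contMDiffAt_const (c := (0 : ℝ)) |>.congr_of_eventuallyEq ?_
      filter_upwards [hnhds] with x hx
      rw [hB, ← Trivialization.symmL_apply (R := ℝ) _ hx]
      simp
    · have hs : ContMDiffAt I I.tangent ∞ (fun x => (⟨x,
          (trivializationAt E (TangentSpace I) x₀).symm x e⟩ : TangentBundle I M)) x₀ := by
        refine contMDiffAt_totalSpace.2 ⟨contMDiffAt_id, ?_⟩
        refine (contMDiffAt_const (c := e)).congr_of_eventuallyEq ?_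
        filter_upwards [hnhds] with x hx
        exact congrArg Prod.snd
          ((trivializationAt E (TangentSpace I) x₀).apply_mk_symm hx e)
      refine ContMDiffAt.comp (f := fun x => (⟨x,
          (trivializationAt E (TangentSpace I) x₀).symm x e⟩ : TangentBundle I M)) x₀
          (smooth _ ?_) hs
      intro h0
      apply he
      have := (trivializationAt E (TangentSpace I) x₀).continuousLinearMapAt_symmL (R := ℝ) hx₀ e
      rw [Trivialization.symmL_apply (R := ℝ) _ hx₀] at this
      rw [← this]
      exact (congrArg _ h0).trans (map_zero _)
  refine contMDiffAt_totalSpace.2 ⟨contMDiffAt_id, ?_⟩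
  refine contMDiffAt_clm_of_apply fun e => contMDiffAt_clm_of_apply fun e' => ?_
  have hev : (fun x => (trivializationAt (E →L[ℝ] E →L[ℝ] ℝ)
        (fun x => TangentSpace I x →L[ℝ] TangentSpace I x →L[ℝ] ℝ) x₀
        (TotalSpace.mk' (E →L[ℝ] E →L[ℝ] ℝ) x (B x))).2 e e') =ᶠ[𝓝 x₀] fun x => (1 / 2) *
      (F ⟨x, (trivializationAt E (TangentSpace I) x₀).symm x (e + e')⟩ ^ 2
        - F ⟨x, (trivializationAt E (TangentSpace I) x₀).symm x e⟩ ^ 2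
        - F ⟨x, (trivializationAt E (TangentSpace I) x₀).symm x e'⟩ ^ 2) := by
    filter_upwards [hnhds] with x hx
    rw [hom_trivializationAt_apply, inCoordinates_apply_eq₂ hx hx (Set.mem_univ _)]
    have hadd := map_add ((trivializationAt E (TangentSpace I) x₀).symmL ℝ x) e e'
    simp only [Trivialization.symmL_apply (R := ℝ) _ hx] at hadd
    rw [hadd, ← hpol]
    simp
  exact (contMDiffAt_const.mul (((hsec _).sub (hsec _)).sub (hsec _))).congr_of_eventuallyEq hev

/-- The square of a Riemannian norm is smooth on the whole tangent bundle. -/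
lemma IsRiemannian.contMDiff_sq {F : TangentBundle I M → ℝ} (hF : IsRiemannian F) :
    ContMDiff I.tangent 𝓘(ℝ, ℝ) ∞ (fun y => F y ^ 2) := by
  obtain ⟨g, hg⟩ := hF
  have hg' : (fun y => F y ^ 2) = fun y : TangentBundle I M => g.inner y.proj y.snd y.snd := by
    ext ⟨x, y⟩
    rw [hg, Real.sq_sqrt]
    rcases eq_or_ne y 0 with rfl | hy
    · simp
    · exact (g.pos x y hy).le
  rw [hg']
  intro y
  have hproj : ContMDiffAt I.tangent I ∞ (fun z : TangentBundle I M => z.proj) y :=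
    contMDiffAt_proj _
  have h : ContMDiffAt I.tangent (I.prod 𝓘(ℝ, ℝ)) ∞ (fun z : TangentBundle I M =>
      TotalSpace.mk' ℝ (E := Bundle.Trivial M ℝ) z.proj (g.inner z.proj z.snd z.snd)) y := by
    apply ContMDiffAt.clm_bundle_apply₂ (F₁ := E) (F₂ := E)
    · exact g.contMDiff.contMDiffAt.comp y hproj
    · exact contMDiffAt_id
    · exact contMDiffAt_id
  rw [contMDiffAt_totalSpace] at h
  exact h.2

/-- The restriction to a fibre of a function on the tangent bundle is smooth wherever the function
is. -/
lemma contDiffAt_fiber {F : TangentBundle I M → ℝ} (x : M) (v : E)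
    (h : ContMDiffAt I.tangent 𝓘(ℝ, ℝ) ∞ F (⟨x, v⟩ : TangentBundle I M)) :
    ContDiffAt ℝ ∞ (fun v : E => F (⟨x, v⟩ : TangentBundle I M)) v := by
  have hincl : ContMDiffAt 𝓘(ℝ, E) I.tangent ∞
      (fun v : E => (⟨x, v⟩ : TangentBundle I M)) v := by
    refine contMDiffAt_totalSpace.2 ⟨contMDiffAt_const, ?_⟩
    have hx : x ∈ (trivializationAt E (TangentSpace I) x).baseSet :=
      FiberBundle.mem_baseSet_trivializationAt' x
    let T : E →L[ℝ] E := (trivializationAt E (TangentSpace I) x).continuousLinearMapAt ℝ x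
    have hT : (fun w : E => (trivializationAt E (TangentSpace I) x ⟨x, w⟩).2) = T := by
      ext w
      exact (congrFun (Trivialization.coe_linearMapAt_of_mem (R := ℝ)
        (trivializationAt E (TangentSpace I) x) hx) w).symm
    have := T.contMDiff.contMDiffAt (n := ∞) (x := v)
    rw [← hT] at this
    exact this
  exact contMDiffAt_iff_contDiffAt.1
    (ContMDiffAt.comp (f := fun v : E => (⟨x, v⟩ : TangentBundle I M)) v h hincl)

end Riemannian

/-! ### C-reducibility on a product of fibres -/

section FibreProduct

variable {E₁ : Type*} [NormedAddCommGroup E₁] [NormedSpace ℝ E₁]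
  {E₂ : Type*} [NormedAddCommGroup E₂] [NormedSpace ℝ E₂]

/-- On a product of fibres, C-reducibility of `G₁ + c G₂` forces the third derivative to vanish:
evaluating the Matsumoto torsion at `(u, (v₁, 0), (0, v₂))` shows that the mean Cartan torsion is
zero. -/
lemma halfThird_eq_zero_of_cReducible {G₁ : E₁ → ℝ} {G₂ : E₂ → ℝ} {c : ℝ} (hc : 0 < c)
    (hG₁ : ∀ y ≠ 0, ContDiffAt ℝ 3 G₁ y)
    (hom₁ : ∀ (a : ℝ) (y : E₁), 0 < a → G₁ (a • y) = a ^ 2 * G₁ y) (pos₁ : ∀ y ≠ 0, 0 < G₁ y)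
    (hG₂ : ∀ y ≠ 0, ContDiffAt ℝ 3 G₂ y)
    (hom₂ : ∀ (a : ℝ) (y : E₂), 0 < a → G₂ (a • y) = a ^ 2 * G₂ y) (pos₂ : ∀ y ≠ 0, 0 < G₂ y)
    {L : E₁ × E₂ → ℝ} (hL : L = fun q => G₁ q.1 + c * G₂ q.2)
    {p : E₁ × E₂} (hp₁ : p.1 ≠ 0) (hp₂ : p.2 ≠ 0)
    {ι : Type*} [Fintype ι] (b : ι → E₁ × E₂) (g : ι → ι → ℝ) {N : ℝ} (hN : N ≠ 0)
    {J : E₁ × E₂ → ℝ} (hJ : ∀ u, J u = ∑ j, ∑ k, g j k * halfThird L p u (b j) (b k))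
    {h : E₁ × E₂ → E₁ × E₂ → ℝ}
    (hh : ∀ u v, h u v = halfHessian L p u v - halfHessian L p p u * halfHessian L p p v / L p)
    (hM : ∀ u v w, halfThird L p u v w - N * (J u * h v w + J v * h u w + J w * h u v) = 0)
    (u v w : E₁ × E₂) : halfThird L p u v w = 0 := by
  have d₁ := hG₁ _ hp₁
  have d₂ := hG₂ _ hp₂
  have third : ∀ u v w, halfThird L p u v w =
      halfThird G₁ p.1 u.1 v.1 w.1 + c * halfThird G₂ p.2 u.2 v.2 w.2 := by
    rw [hL]
    exact halfThird_prod d₁ d₂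
  have hess : ∀ u v, halfHessian L p u v =
      halfHessian G₁ p.1 u.1 v.1 + c * halfHessian G₂ p.2 u.2 v.2 := by
    rw [hL]
    exact halfHessian_prod (d₁.of_le (by norm_num)) (d₂.of_le (by norm_num))
  -- Every term of the trace vanishes, whatever the coefficients `g`: one block has a radial
  -- argument, the other a zero argument.
  have J₁ : J (p.1, 0) = 0 := by
    simp [hJ, third, halfThird_self_left hG₁ hom₁ hp₁, halfThird_zero_left d₂]
  have J₂ : J (0, p.2) = 0 := by
    simp [hJ, third, halfThird_self_left hG₂ hom₂ hp₂, halfThird_zero_left d₁]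
  have hLp : 0 < L p := by
    have := pos₁ _ hp₁
    have := pos₂ _ hp₂
    rw [hL]
    positivity
  have hne : h (p.1, 0) (0, p.2) ≠ 0 := by
    have e : h (p.1, 0) (0, p.2) = -(G₁ p.1 * (c * G₂ p.2) / L p) := by
      simp [hh, hess, halfHessian_self hG₁ hom₁ hp₁, halfHessian_self hG₂ hom₂ hp₂,
        halfHessian_zero_right (d₁.of_le (show (2 : WithTop ℕ∞) ≤ 3 by norm_num)),
        halfHessian_zero_left (d₂.of_le (show (2 : WithTop ℕ∞) ≤ 3 by norm_num)),
        halfHessian_zero_right (d₂.of_le (show (2 : WithTop ℕ∞) ≤ 3 by norm_num))]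
    rw [e]
    have := pos₁ _ hp₁
    have := pos₂ _ hp₂
    exact neg_ne_zero.2 (by positivity)
  -- The torsion term vanishes because each block has a zero argument, so only N · J u · h((p₁, 0),
  -- (0, p₂)) survives.
  have Jz : ∀ u, J u = 0 := fun u => by
    have := hM u (p.1, 0) (0, p.2)
    rw [third, J₁, J₂] at this
    simpa [halfThird_zero_right d₁, halfThird_zero_middle d₂, hN, hne] using this
  simpa [Jz] using hM u v w

end FibreProduct

/-! ### Finsler metrics restricted to a fibre -/

section Fibre

variable {E : Type*} [NormedAddCommGroup E] [NormedSpace ℝ E]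
  {H : Type*} [TopologicalSpace H] {I : ModelWithCorners ℝ E H}
  {M : Type*} [TopologicalSpace M] [ChartedSpace H M] [IsManifold I ∞ M]
  {F : TangentBundle I M → ℝ}

/-- The square of `F` on the tangent space at `x`, as a function on the model space. -/
def fibreSq (F : TangentBundle I M → ℝ) (x : M) (v : E) : ℝ :=
  F (⟨x, v⟩ : TangentBundle I M) ^ 2

namespace IsFinslerMetric

variable (hF : IsFinslerMetric F)
include hF

/-- The complement of the zero section is a neighbourhood of `y`: a trivialization is a linear
isomorphism on each fibre, so it detects nonzero vectors. -/
lemma contMDiffAt {y : TangentBundle I M} (hy : y.snd ≠ 0) :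
    ContMDiffAt I.tangent 𝓘(ℝ, ℝ) ∞ F y := by
  refine hF.smooth.contMDiffAt ?_
  let e := trivializationAt E (TangentSpace I) y.proj
  have hopen : IsOpen (e.source ∩ e ⁻¹' {q | q.2 ≠ 0}) :=
    e.continuousOn.isOpen_inter_preimage e.open_source
      (isOpen_ne.preimage continuous_snd)
  have hzero : ∀ z : TangentBundle I M, z ∈ e.source → ((e z).2 ≠ 0 ↔ z.snd ≠ 0) := by
    rintro ⟨x, v⟩ hz
    have hx : x ∈ e.baseSet := e.mem_source.1 hz
    rw [← congrFun (Bundle.Trivialization.continuousLinearEquivAt_apply (R := ℝ) e x hx) v]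
    exact (e.continuousLinearEquivAt ℝ x hx).map_ne_zero_iff
  have hys : y ∈ e.source :=
    e.mem_source.2 (FiberBundle.mem_baseSet_trivializationAt' y.proj)
  filter_upwards [hopen.mem_nhds ⟨hys, (hzero y hys).2 hy⟩] with z hz
  exact (hzero z hz.1).1 hz.2

lemma contDiffAt_fibreSq (x : M) (v : E) (hv : v ≠ 0) : ContDiffAt ℝ 3 (fibreSq F x) v :=
  ((contDiffAt_fiber x v (hF.contMDiffAt (y := ⟨x, v⟩) hv)).pow 2).of_le ENat.LEInfty.out

lemma fibreSq_smul (x : M) (a : ℝ) (v : E) (ha : 0 < a) :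
    fibreSq F x (a • v) = a ^ 2 * fibreSq F x v := by
  have := hF.homogeneous x v a ha
  refine Eq.trans ?_ (mul_pow a _ 2)
  exact congrArg (· ^ 2) this

/-- Euler's relation F²(v) = g_v(v, v) turns positive definiteness into positivity of F. -/
lemma fibreSq_pos (x : M) (v : E) (hv : v ≠ 0) : 0 < fibreSq F x v := by
  rw [← halfHessian_self (hF.contDiffAt_fibreSq x) (hF.fibreSq_smul x) hv]
  exact hF.posDef ⟨x, v⟩ hv v hv

lemma pos (y : TangentBundle I M) (hy : y.snd ≠ 0) : 0 < F y :=
  (hF.nonneg y).lt_of_ne fun h => (hF.fibreSq_pos y.proj y.snd hy).ne (by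
    show 0 = F y ^ 2
    simp [← h])

/-- A Finsler metric with vanishing Cartan torsion is Riemannian. -/
lemma exists_bilin [FiniteDimensional ℝ E]
    (hrev : Module.finrank ℝ E = 1 → IsReversible F) (x : M)
    (hC : ∀ y ≠ 0, ∀ u v w, halfThird (fibreSq F x) y u v w = 0) :
    ∃ B : E →L[ℝ] E →L[ℝ] ℝ, ∀ v, fibreSq F x v = B v v :=
  exists_bilin_of_halfThird_eq_zero (hF.contDiffAt_fibreSq x) (hF.fibreSq_smul x)
    (fun h v => congrArg (· ^ 2) (hrev h x v)) hC

lemma isRiemannian [FiniteDimensional ℝ E]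
    (quad : ∀ x : M, ∃ B : E →L[ℝ] E →L[ℝ] ℝ, ∀ v, fibreSq F x v = B v v) : IsRiemannian F :=
  isRiemannian_of_quadratic hF.nonneg (fun _ hy => (hF.contMDiffAt hy).pow 2) hF.pos quad

end IsFinslerMetric

end Fibre

/-! ### The twisted product metric -/

section Twisted

variable {E₁ : Type*} [NormedAddCommGroup E₁] [NormedSpace ℝ E₁] [FiniteDimensional ℝ E₁]
  {H₁ : Type*} [TopologicalSpace H₁] {I₁ : ModelWithCorners ℝ E₁ H₁}
  {M₁ : Type*} [TopologicalSpace M₁] [ChartedSpace H₁ M₁] [IsManifold I₁ ∞ M₁]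
  {E₂ : Type*} [NormedAddCommGroup E₂] [NormedSpace ℝ E₂] [FiniteDimensional ℝ E₂]
  {H₂ : Type*} [TopologicalSpace H₂] {I₂ : ModelWithCorners ℝ E₂ H₂}
  {M₂ : Type*} [TopologicalSpace M₂] [ChartedSpace H₂ M₂] [IsManifold I₂ ∞ M₂]
  {F₁ : TangentBundle I₁ M₁ → ℝ} {F₂ : TangentBundle I₂ M₂ → ℝ} {f : M₁ × M₂ → ℝ}

omit [FiniteDimensional ℝ E₁] [IsManifold I₁ ∞ M₁] [FiniteDimensional ℝ E₂]
  [IsManifold I₂ ∞ M₂] in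
lemma fibreSq_twistedProduct (x : M₁ × M₂) (p : E₁ × E₂) :
    fibreSq (twistedProduct F₁ F₂ f) x p = fibreSq F₁ x.1 p.1 + f x ^ 2 * fibreSq F₂ x.2 p.2 :=
  Real.sq_sqrt (by positivity)

/-- The Cartan torsion of a C-reducible twisted product metric vanishes. -/
lemma halfThird_fibreSq_twistedProduct_eq_zero (hF₁ : IsFinslerMetric F₁)
    (hF₂ : IsFinslerMetric F₂) (hfpos : ∀ p, 0 < f p)
    (hC : IsCReducibleOn (twistedProduct F₁ F₂ f) (slitProduct I₁ M₁ I₂ M₂))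
    (x : M₁ × M₂) {p : E₁ × E₂} (hp₁ : p.1 ≠ 0) (hp₂ : p.2 ≠ 0) (u v w : E₁ × E₂) :
    halfThird (fibreSq (twistedProduct F₁ F₂ f) x) p u v w = 0 := by
  let y : TangentBundle (I₁.prod I₂) (M₁ × M₂) := ⟨x, p⟩
  -- The tensors on the tangent bundle unfold to `halfHessian` and `halfThird` of `fibreSq`, hence
  -- the proofs by `rfl`.
  refine halfThird_eq_zero_of_cReducible (pow_pos (hfpos x) 2)
    (hF₁.contDiffAt_fibreSq x.1) (hF₁.fibreSq_smul x.1) (hF₁.fibreSq_pos x.1)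
    (hF₂.contDiffAt_fibreSq x.2) (hF₂.fibreSq_smul x.2) (hF₂.fibreSq_pos x.2)
    (funext (fibreSq_twistedProduct x)) hp₁ hp₂ (Module.finBasis ℝ (E₁ × E₂))
    (fun j k => (gramMatrix (twistedProduct F₁ F₂ f) y)⁻¹ j k)
    (N := 1 / ((Module.finrank ℝ (E₁ × E₂) : ℝ) + 1)) (by positivity)
    (J := meanCartanTorsion (twistedProduct F₁ F₂ f) y) (fun u => rfl)
    (h := angularMetric (twistedProduct F₁ F₂ f) y) (fun u v => rfl) (fun u v w => ?_) u v w
  exact hC y ⟨hp₁, hp₂⟩ u v w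

/-- Arguments tangent to one factor isolate its block. The other component of the base vector is any
nonzero vector, so that C-reducibility on the slit product applies. -/
lemma halfThird_fibreSq_eq_zero [Nontrivial E₁] [Nontrivial E₂] (hF₁ : IsFinslerMetric F₁)
    (hF₂ : IsFinslerMetric F₂) (hfpos : ∀ p, 0 < f p)
    (hC : IsCReducibleOn (twistedProduct F₁ F₂ f) (slitProduct I₁ M₁ I₂ M₂)) (x : M₁ × M₂) :
    (∀ y ≠ 0, ∀ u v w, halfThird (fibreSq F₁ x.1) y u v w = 0) ∧
      ∀ y ≠ 0, ∀ u v w, halfThird (fibreSq F₂ x.2) y u v w = 0 := by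
  have hprod : ∀ (p : E₁ × E₂), p.1 ≠ 0 → p.2 ≠ 0 → ∀ u v w : E₁ × E₂,
      halfThird (fibreSq F₁ x.1) p.1 u.1 v.1 w.1
        + f x ^ 2 * halfThird (fibreSq F₂ x.2) p.2 u.2 v.2 w.2 = 0 := fun p h₁ h₂ u v w => by
    rw [← halfThird_prod (hF₁.contDiffAt_fibreSq x.1 _ h₁) (hF₂.contDiffAt_fibreSq x.2 _ h₂),
      ← halfThird_fibreSq_twistedProduct_eq_zero hF₁ hF₂ hfpos hC x h₁ h₂ u v w]
    exact congrArg (halfThird · p u v w) (funext (fibreSq_twistedProduct x)).symm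
  obtain ⟨e₁, he₁⟩ := exists_ne (0 : E₁)
  obtain ⟨e₂, he₂⟩ := exists_ne (0 : E₂)
  constructor
  · intro y hy u v w
    simpa [halfThird_zero_left (hF₂.contDiffAt_fibreSq x.2 _ he₂)] using
      hprod (y, e₂) hy he₂ (u, 0) (v, 0) (w, 0)
  · intro y hy u v w
    simpa [halfThird_zero_left (hF₁.contDiffAt_fibreSq x.1 _ he₁), (hfpos x).ne'] using
      hprod (e₁, y) he₁ hy (0, u) (0, v) (0, w)

/-- The twisted product of two Riemannian Finsler metrics is Riemannian. -/
lemma isRiemannian_twistedProduct (hF₁ : IsFinslerMetric F₁) (hF₂ : IsFinslerMetric F₂)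
    (hf : ContMDiff (I₁.prod I₂) 𝓘(ℝ, ℝ) ∞ f) (hfpos : ∀ p, 0 < f p)
    (hR₁ : IsRiemannian F₁) (hR₂ : IsRiemannian F₂)
    (quad₁ : ∀ x, ∃ B : E₁ →L[ℝ] E₁ →L[ℝ] ℝ, ∀ v, fibreSq F₁ x v = B v v)
    (quad₂ : ∀ x, ∃ B : E₂ →L[ℝ] E₂ →L[ℝ] ℝ, ∀ v, fibreSq F₂ x v = B v v) :
    IsRiemannian (twistedProduct F₁ F₂ f) := by
  refine isRiemannian_of_quadratic (fun _ => Real.sqrt_nonneg _) (fun y _ => ?_) (fun y hy => ?_)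
    (fun x => ?_)
  -- One of v₁, v₂ may vanish here, where smoothness of Fᵢ off the zero section is not enough;
  -- Riemannian norms have squares smooth everywhere.
  · have hequiv : ContMDiffAt (I₁.prod I₂).tangent (I₁.tangent.prod I₂.tangent) ∞
        (equivTangentBundleProd I₁ M₁ I₂ M₂) y := by
      exact contMDiff_equivTangentBundleProd.contMDiffAt
    have hproj : ContMDiffAt (I₁.prod I₂).tangent (I₁.prod I₂) ∞
        (fun z : TangentBundle (I₁.prod I₂) (M₁ × M₂) => z.proj) y :=
      Bundle.contMDiffAt_proj _
    have h1 := hR₁.contMDiff_sq.contMDiffAt.comp y (contMDiffAt_fst.comp y hequiv)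
    have h2 := hR₂.contMDiff_sq.contMDiffAt.comp y (contMDiffAt_snd.comp y hequiv)
    have h3 := (hf.contMDiffAt.comp y hproj).pow 2
    refine (h1.add (h3.mul h2)).congr_of_eventuallyEq (Filter.Eventually.of_forall fun z => ?_)
    exact Real.sq_sqrt (by positivity)
  · have hor : y.snd.1 ≠ 0 ∨ y.snd.2 ≠ 0 := by
      by_contra! h
      exact hy (Prod.ext h.1 h.2)
    have hfy := hfpos y.proj
    refine Real.sqrt_pos.2 ?_
    rcases hor with h | h
    · have := hF₁.fibreSq_pos y.proj.1 y.snd.1 h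
      exact add_pos_of_pos_of_nonneg this (by positivity)
    · have := hF₂.fibreSq_pos y.proj.2 y.snd.2 h
      exact add_pos_of_nonneg_of_pos (by positivity) (mul_pos (by positivity) this)
  · obtain ⟨B₁, hB₁⟩ := quad₁ x.1
    obtain ⟨B₂, hB₂⟩ := quad₂ x.2
    let p₁ := ContinuousLinearMap.fst ℝ E₁ E₂
    let p₂ := ContinuousLinearMap.snd ℝ E₁ E₂
    let B : E₁ × E₂ →L[ℝ] E₁ × E₂ →L[ℝ] ℝ :=
      B₁.bilinearComp p₁ p₁ + f x ^ 2 • B₂.bilinearComp p₂ p₂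
    refine ⟨B, fun p => ?_⟩
    have hBp : B p p = B₁ p.1 p.1 + f x ^ 2 * B₂ p.2 p.2 := rfl
    refine (fibreSq_twistedProduct x p).trans ?_
    rw [hB₁, hB₂]
    exact hBp.symm

end Twisted

end Finsler

theorem mainTheorem1
    (n₁ n₂ : ℕ) (hn₁ : 0 < n₁) (hn₂ : 0 < n₂)
    (M₁ : Type*) [TopologicalSpace M₁] [Nonempty M₁]
    [ChartedSpace (EuclideanSpace ℝ (Fin n₁)) M₁] [IsManifold (𝓡 n₁) ∞ M₁]
    (M₂ : Type*) [TopologicalSpace M₂] [Nonempty M₂]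
    [ChartedSpace (EuclideanSpace ℝ (Fin n₂)) M₂] [IsManifold (𝓡 n₂) ∞ M₂]
    (F₁ : TangentBundle (𝓡 n₁) M₁ → ℝ) (hF₁ : Finsler.IsFinslerMetric F₁)
    (F₂ : TangentBundle (𝓡 n₂) M₂ → ℝ) (hF₂ : Finsler.IsFinslerMetric F₂)
    (hrev₁ : n₁ = 1 → Finsler.IsReversible F₁) (hrev₂ : n₂ = 1 → Finsler.IsReversible F₂)
    (f : M₁ × M₂ → ℝ) (hf : ContMDiff ((𝓡 n₁).prod (𝓡 n₂)) 𝓘(ℝ, ℝ) ∞ f)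
    (hfpos : ∀ p, 0 < f p)
    (hC : Finsler.IsCReducibleOn (Finsler.twistedProduct F₁ F₂ f)
      (Finsler.slitProduct (𝓡 n₁) M₁ (𝓡 n₂) M₂)) :
    Finsler.IsRiemannian (Finsler.twistedProduct F₁ F₂ f) ∧
      Finsler.IsRiemannian F₁ ∧ Finsler.IsRiemannian F₂ := by
  have : Nonempty (Fin n₁) := ⟨⟨0, hn₁⟩⟩
  have : Nonempty (Fin n₂) := ⟨⟨0, hn₂⟩⟩
  obtain ⟨x₁⟩ := ‹Nonempty M₁›
  obtain ⟨x₂⟩ := ‹Nonempty M₂›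
  have hzero := Finsler.halfThird_fibreSq_eq_zero hF₁ hF₂ hfpos hC
  -- A fixed point of the other manifold places `x` in the product.
  have quad₁ := fun x => hF₁.exists_bilin (by simpa using hrev₁) x (hzero (x, x₂)).1
  have quad₂ := fun x => hF₂.exists_bilin (by simpa using hrev₂) x (hzero (x₁, x)).2
  have hR₁ := hF₁.isRiemannian quad₁
  have hR₂ := hF₂.isRiemannian quad₂
  exact ⟨Finsler.isRiemannian_twistedProduct hF₁ hF₂ hf hfpos hR₁ hR₂ quad₁ quad₂, hR₁, hR₂⟩
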